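/- Let $G^\dagger=(V^\dagger,E^\dagger)$ be a finite loopless multigraph, let some of its vertices be designated as blossom vertices, and let $w^\dagger\in\mathbb R^{E^\dagger}$ be arbitrary edge weights (this includes every contracted graph with its modified weights that occurs in an iteration of Blossom-LP). Let $\delta(v)$ be the set of edges incident to $v$. The LP of the iteration is $$(\mathrm{LP}^\dagger)\quad \min w^\dagger\cdot y\ \text{ s.t. } \sum_{e\in\delta(v)}y_e=1\ (v\text{ non-blossom}),\quad \sum_{e\in\delta(v)}y_e\ge 1\ (v\text{ blossom}),\quad y\in[0,1]^{E^\dagger}.$$ Replace every $e\in E^\dagger$ by two parallel copies $e_1,e_2$, giving $E^\ddagger$. For weights $w^\ddagger\in\mathbb R^{E^\ddagger}$ consider the doubled-edge LP $$(\mathrm{LP}^\ddagger)\quad \min w^\ddagger\cdot x\ \text{ s.t. } \sum_{e\in\delta(v)}x_e=2\ (v\text{ non-blossom}),\quad \sum_{e\in\delta(v)}x_e\ge 2\ (v\text{ blossom}),\quad x\in[0,1]^{E^\ddagger},$$ and the graphical model on $x\in\{0,1\}^{E^\ddagger}$ $$\Pr[X=x]\propto\prod_{e\in E^\ddagger}e^{-w^\ddagger_e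 x_e}\prod_{v\in V^\dagger}\psi_v(x_{\delta(v)}),$$ where $\psi_v$ is the $0/1$ indicator of the constraint of $(\mathrm{LP}^\ddagger)$ at $v$. Max-product BP is run with the parallel updates $$m^{t+1}_{v\to e}(c)=\max_{z\in\{0,1\}^{\delta(v)}:\,z_e=c}\psi_v(z)\prod_{f\in\delta(v)\setminus e}m^t_{f\to v}(z_f),\qquad m^{t+1}_{e\to v}(c)=e^{-w^\ddagger_e c}\prod_{u\ne v:\,e\in\delta(u)}m^t_{u\to e}(c)$$ from arbitrary strictly positive initial messages. It outputs at $e$ the value $c\in\{0,1\}$ with the larger belief $b_e[c]=e^{-w^\ddagger_e c}\prod_{v:\,e\in\delta(v)}m_{v\to e}(c)$, and "?" in case of a tie. It converges to $x$ if from some iteration on the output is $x_e$ at every $e$. 1. Let $w^\ddagger_{e_1}=w^\ddagger_{e_2}=w^\dagger_e$ for all $e$. If $(\mathrm{LP}^\ddagger)$ has a unique optimal solution $x$, then BP converges to $x$. Moreover, $y_e=\tfrac12(x_{e_1}+x_{e_2})$ is then the unique optimal solution of $(\mathrm{LP}^\dagger)$, and $y\in\{0,\tfrac12,1\}^{E^\dagger}$.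 2. BP computes the half-integral solution of $(\mathrm{LP}^\dagger)$ after a small perturbation of the weights of the copies: if $(\mathrm{LP}^\dagger)$ has a unique optimal solution $y$, then $y\in\{0,\tfrac12,1\}^{E^\dagger}$, and there is $\varepsilon>0$ such that for all $w^\ddagger$ with $|w^\ddagger_{e_i}-w^\dagger_e|\le\varepsilon$ ($i=1,2$) and $w^\ddagger_{e_1}\ne w^\ddagger_{e_2}$ for every $e$, $(\mathrm{LP}^\ddagger)$ has a unique optimal solution $x$, BP converges to $x$, and $\tfrac12(x_{e_1}+x_{e_2})=y_e$ for every $e$. -/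

import Mathlib

noncomputable section

namespace BlossomBP

open scoped Classical

/-- A finite-variable graphical model over binary variables `z : I → {0,1}`: the joint weight of `z`
is proportional to `∏ i, varFactor i (z i) * ∏ a, factor a (z restricted to scope a)`. -/
structure GraphicalModel (I F : Type*) where
  /-- the set of variables on which the factor `a` depends -/
  scope : F → Finset I
  varFactor : I → Fin 2 → ℝ
  factor : (a : F) → (scope a → Fin 2) → ℝ
  varFactor_nonneg : ∀ i c, 0 ≤ varFactor i c
  factor_nonneg : ∀ a z, 0 ≤ factor a z

namespace GraphicalModel

variable {I F : Type*}

/-- One family of messages: `toVar a i c` is `m_{a → i}(c)` and `toFactor a i c` is `m_{i → a}(c)`,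
for every factor `a` and every variable `i` in its scope. -/
structure Messages (M : GraphicalModel I F) where
  toVar : (a : F) → M.scope a → Fin 2 → ℝ
  toFactor : (a : F) → M.scope a → Fin 2 → ℝ

/-- All messages are strictly positive. -/
def Messages.Positive {M : GraphicalModel I F} (m : M.Messages) : Prop :=
  ∀ a i c, 0 < m.toVar a i c ∧ 0 < m.toFactor a i c

/-- The max-product update, carried out in parallel for all messages. The supremum runs over the
finite nonempty set of local assignments `z` with `z i = c`, so it is a maximum. -/
def step [Fintype F] (M : GraphicalModel I F) (m : M.Messages) : M.Messages where
  toVar a i c :=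
    ⨆ z : {z : M.scope a → Fin 2 // z i = c},
      M.factor a z.1 * ∏ j ∈ Finset.univ.erase i, m.toFactor a j (z.1 j)
  toFactor a i c :=
    M.varFactor i c *
      ∏ b : {b : F // b ≠ a ∧ (i : I) ∈ M.scope b}, m.toVar b.1 ⟨i, b.2.2⟩ c

/-- The messages after `t` iterations of max-product BP started from `m₀`. -/
def messages [Fintype F] (M : GraphicalModel I F) (m₀ : M.Messages) (t : ℕ) : M.Messages :=
  M.step^[t] m₀

/-- The (max-marginal) belief `b_i[c]`. -/
def belief [Fintype F] (M : GraphicalModel I F) (m : M.Messages) (i : I) (c : Fin 2) : ℝ :=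
  M.varFactor i c * ∏ a : {a : F // i ∈ M.scope a}, m.toVar a.1 ⟨i, a.2⟩ c

/-- The decision of BP at the variable `i`; `none` stands for the undecided output `?`. -/
def output [Fintype F] (M : GraphicalModel I F) (m : M.Messages) (i : I) : Option (Fin 2) :=
  if M.belief m i 0 < M.belief m i 1 then some 1
  else if M.belief m i 1 < M.belief m i 0 then some 0
  else none

/-- Max-product BP started from `m₀` converges to the vector `x`: after finitely many iterations
the output at every variable `i` is, and remains, the value `x i`. -/
def BPConvergesTo [Fintype F] (M : GraphicalModel I F) (m₀ : M.Messages) (x : I → ℝ) : Prop :=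
  ∃ T : ℕ, ∀ t, T ≤ t → ∀ i, ∃ c : Fin 2,
    M.output (M.messages m₀ t) i = some c ∧ x i = ((c : ℕ) : ℝ)

end GraphicalModel

/-- A loopless multigraph with vertices `V` and edges `E`; parallel edges are allowed (they arise
from contractions and from doubling edges). -/
structure Multigraph (V E : Type*) where
  ends : E → Sym2 V
  loopless : ∀ e, ¬ (ends e).IsDiag

namespace Multigraph

variable {V E : Type*}

/-- The set `δ(v)` of edges incident to `v`. -/
def delta [Fintype E] (G : Multigraph V E) (v : V) : Finset E :=
  Finset.univ.filter fun e => v ∈ G.ends e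

/-- Every edge `e` is replaced by two parallel copies `(e, 0)` and `(e, 1)`. -/
def double (G : Multigraph V E) : Multigraph V (E × Fin 2) where
  ends p := G.ends p.1
  loopless p := G.loopless p.1

/-- The polytope with degree `= d` at non-blossom vertices, degree `≥ d` at blossom vertices
(the vertices in `B`), and all entries in `[0,1]`. -/
def Feasible [Fintype E] (G : Multigraph V E) (B : Set V) (d : ℕ) (x : E → ℝ) : Prop :=
  (∀ v, v ∉ B → ∑ e ∈ G.delta v, x e = d) ∧
  (∀ v, v ∈ B → (d : ℝ) ≤ ∑ e ∈ G.delta v, x e) ∧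
  (∀ e, 0 ≤ x e ∧ x e ≤ 1)

/-- `x` is an optimal solution of the LP: minimize `w · x` over the above polytope. -/
def IsSolution [Fintype E] (G : Multigraph V E) (B : Set V) (d : ℕ) (w x : E → ℝ) : Prop :=
  G.Feasible B d x ∧ ∀ y, G.Feasible B d y → ∑ e, w e * x e ≤ ∑ e, w e * y e

/-- `x` is the only optimal solution of the LP. -/
def IsUniqueSolution [Fintype E] (G : Multigraph V E) (B : Set V) (d : ℕ) (w x : E → ℝ) : Prop :=
  G.IsSolution B d w x ∧ ∀ y, G.IsSolution B d w y → y = x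

/-- The graphical model of the LP: one variable for each edge `e`, with variable factor
`exp (- w e * x e)`, and for each vertex `v` the indicator of the degree constraint at `v`. -/
def degreeGM [Fintype E] (G : Multigraph V E) (B : Set V) (d : ℕ) (w : E → ℝ) :
    GraphicalModel E V where
  scope v := G.delta v
  varFactor e c := Real.exp (-(w e * ((c : ℕ) : ℝ)))
  factor v z :=
    if (v ∉ B ∧ ∑ e, (z e : ℕ) = d) ∨ (v ∈ B ∧ d ≤ ∑ e, (z e : ℕ)) then 1 else 0
  varFactor_nonneg _ _ := (Real.exp_pos _).le
  factor_nonneg _ _ := by split_ifs <;> norm_num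

end Multigraph

/-- The vector on the edges obtained by averaging over the two copies of each edge. -/
def halfSum {E : Type*} (x : E × Fin 2 → ℝ) : E → ℝ := fun e => (x (e, 0) + x (e, 1)) / 2

/-- All entries lie in `{0, 1/2, 1}`. -/
def HalfIntegral {E : Type*} (y : E → ℝ) : Prop := ∀ e, y e = 0 ∨ y e = 1 / 2 ∨ y e = 1

end BlossomBP

end

/-!
Belief propagation is analysed through an optimal dual solution instead of a computation tree. If a
`0/1` vector `x` is the only optimal solution of the degree program, separating `w` from an open
convex cone gives dual variables `l v` with strict complementary slackness: the reduced cost of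
every edge is nonzero and favours the value `x e`
(`Multigraph.IsUniqueSolution.exists_strict_dual`). A degree constraint has an exchange property: a
feasible local assignment that is wrong at one edge can be corrected there, either alone or together
with one further wrong edge of the opposite sign (`DegreeOK.exchange`). As every edge has at most two
ends, the logarithmic message ratios in favour of `x` therefore satisfy a recursion of Bellman–Ford
type, in which the variables `l v` act as potentials: once shifted by them, the ratios gain a fixed
positive amount in every iteration until they are nonnegative (`Multigraph.RatioBound.step`). From
then on all beliefs decide for `x` (`Multigraph.IsUniqueSolution.bpConvergesTo`). Messages may vanish,
so the ratios are handled as multiplicative inequalities.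

A unique optimal solution of the program with degrees `1` is half-integral by a dimension count on
its fractional edges (`Multigraph.IsUniqueSolution.halfIntegral`). Averaging over the copies relates
the doubled program to the original one. With equal weights on the copies, a value `1/2` could be
split into `1` and `0` at no cost, so uniqueness forces integrality
(`Multigraph.IsUniqueSolution.double_integral`). With slightly different weights, the cost of the
averages grows linearly away from the optimum (`Multigraph.IsUniqueSolution.exists_sharp`), which
absorbs the perturbation, and each value `1/2` goes to the lighter copy
(`Multigraph.IsUniqueSolution.exists_perturbation`). In both cases the doubled program has a unique
`0/1` optimum, to which the convergence theorem applies.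
-/

namespace BlossomBP

open scoped Classical

namespace Multigraph

variable {V E : Type*} [Fintype E] {G : Multigraph V E} {B : Set V} {d : ℕ}
  {w x y : E → ℝ}

/-! ### Feasible directions -/

/-- `D` is a feasible direction at the point `x` of the degree polytope: it respects every
constraint that is tight at `x`. -/
structure IsFeasibleDirection (G : Multigraph V E) (B : Set V) (d : ℕ) (x D : E → ℝ) : Prop where
  sum_eq_zero : ∀ v, v ∉ B → ∑ e ∈ G.delta v, D e = 0
  sum_nonneg : ∀ v, v ∈ B → ∑ e ∈ G.delta v, x e = d → 0 ≤ ∑ e ∈ G.delta v, D e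
  nonneg : ∀ e, x e = 0 → 0 ≤ D e
  nonpos : ∀ e, x e = 1 → D e ≤ 0

theorem mem_delta {e : E} {v : V} : e ∈ G.delta v ↔ v ∈ G.ends e := by
  simp [delta]

theorem Feasible.isFeasibleDirection_sub (hx : G.Feasible B d x) (hy : G.Feasible B d y) :
    G.IsFeasibleDirection B d x (y - x) where
  sum_eq_zero v hv := by simp [hx.1 v hv, hy.1 v hv]
  sum_nonneg v hv h := by simpa [h] using hy.2.1 v hv
  nonneg e h := by simpa [h] using (hy.2.2 e).1
  nonpos e h := by simpa [h] using (hy.2.2 e).2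

theorem IsFeasibleDirection.smul {D : E → ℝ} (hD : G.IsFeasibleDirection B d x D) {c : ℝ}
    (hc : 0 ≤ c) : G.IsFeasibleDirection B d x (c • D) where
  sum_eq_zero v hv := by simp [← Finset.mul_sum, hD.sum_eq_zero v hv]
  sum_nonneg v hv h := by
    simpa [← Finset.mul_sum] using mul_nonneg hc (hD.sum_nonneg v hv h)
  nonneg e h := mul_nonneg hc (hD.nonneg e h)
  nonpos e h := mul_nonpos_of_nonneg_of_nonpos hc (hD.nonpos e h)

/-- Moving a little from `x` in a feasible direction stays in the polytope. -/
theorem IsFeasibleDirection.exists_feasible [Finite V] {D : E → ℝ} (hx : G.Feasible B d x)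
    (hD : G.IsFeasibleDirection B d x D) : ∃ t : ℝ, 0 < t ∧ G.Feasible B d (x + t • D) := by
  have key : ∀ a b : ℝ, 0 ≤ a → (a = 0 → 0 ≤ b) → ∀ᶠ t in nhdsWithin (0 : ℝ) (Set.Ioi 0),
      0 ≤ a + t * b := by
    intro a b ha hab
    rcases ha.eq_or_lt with rfl | ha
    · filter_upwards [self_mem_nhdsWithin] with t ht
      simpa using mul_nonneg (le_of_lt ht) (hab rfl)
    · have : Filter.Tendsto (fun t : ℝ => a + t * b) (nhdsWithin 0 (Set.Ioi 0)) (nhds a) := by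
        have : ContinuousAt (fun t : ℝ => a + t * b) 0 := by fun_prop
        simpa using this.tendsto.mono_left nhdsWithin_le_nhds
      exact (this.eventually (lt_mem_nhds ha)).mono fun t ht => le_of_lt ht
  have h1 : ∀ᶠ t in nhdsWithin (0 : ℝ) (Set.Ioi 0), ∀ e, 0 ≤ x e + t * D e :=
    Filter.eventually_all.2 fun e => key _ _ (hx.2.2 e).1 (hD.nonneg e)
  have h2 : ∀ᶠ t in nhdsWithin (0 : ℝ) (Set.Ioi 0), ∀ e, 0 ≤ (1 - x e) + t * (-D e) :=
    Filter.eventually_all.2 fun e => key _ _ (by linarith [(hx.2.2 e).2])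
      fun h => by linarith [hD.nonpos e (by linarith)]
  have h3 : ∀ᶠ t in nhdsWithin (0 : ℝ) (Set.Ioi 0), ∀ v, v ∈ B →
      0 ≤ (∑ e ∈ G.delta v, x e - d) + t * ∑ e ∈ G.delta v, D e :=
    Filter.eventually_all.2 fun v => by
      by_cases hv : v ∈ B
      · simpa [hv] using key _ _ (by linarith [hx.2.1 v hv])
          fun h => hD.sum_nonneg v hv (by linarith)
      · simp [hv]
  have h0 : ∀ᶠ t in nhdsWithin (0 : ℝ) (Set.Ioi 0), 0 < t := self_mem_nhdsWithin
  obtain ⟨t, ht, h1, h2, h3⟩ := (h0.and (h1.and (h2.and h3))).exists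
  refine ⟨t, ht, fun v hv => ?_, fun v hv => ?_, fun e => ⟨h1 e, ?_⟩⟩
  · simp [Finset.sum_add_distrib, ← Finset.mul_sum, hx.1 v hv, hD.sum_eq_zero v hv]
  · have := h3 v hv
    simp only [Pi.add_apply, Pi.smul_apply, smul_eq_mul, Finset.sum_add_distrib,
      ← Finset.mul_sum]
    linarith
  · have := h2 e
    simp only [Pi.add_apply, Pi.smul_apply, smul_eq_mul]
    linarith

theorem IsUniqueSolution.pos_of_isFeasibleDirection [Finite V] {D : E → ℝ}
    (hx : G.IsUniqueSolution B d w x) (hD : G.IsFeasibleDirection B d x D) (hD0 : D ≠ 0) :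
    0 < ∑ e, w e * D e := by
  obtain ⟨t, ht, hf⟩ := hD.exists_feasible hx.1.1
  by_contra! hle
  have hsum : ∑ e, w e * (x + t • D) e = ∑ e, w e * x e + t * ∑ e, w e * D e := by
    simp only [Finset.mul_sum, ← Finset.sum_add_distrib, Pi.add_apply, Pi.smul_apply, smul_eq_mul]
    exact Finset.sum_congr rfl fun e _ => by ring
  have hsol : G.IsSolution B d w (x + t • D) := ⟨hf, fun y hy => by
    rw [hsum]
    linarith [hx.1.2 y hy, mul_nonpos_of_nonneg_of_nonpos ht.le hle]⟩
  have := hx.2 _ hsol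
  apply hD0
  simpa [ht.ne'] using this

/-- A unique optimal solution is sharp: the cost grows at least linearly in the distance to it. -/
theorem IsUniqueSolution.exists_sharp [Finite V] (hx : G.IsUniqueSolution B d w x) :
    ∃ δ : ℝ, 0 < δ ∧ ∀ y, G.Feasible B d y →
      δ * ∑ e, |y e - x e| ≤ ∑ e, w e * (y e - x e) := by
  let S : Set (E → ℝ) := {D | G.IsFeasibleDirection B d x D ∧ ∑ e, |D e| = 1}
  have hclosed : IsClosed S := by
    have : S = {D | (∀ v, v ∉ B → ∑ e ∈ G.delta v, D e = 0) ∧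
        (∀ v, v ∈ B → ∑ e ∈ G.delta v, x e = d → 0 ≤ ∑ e ∈ G.delta v, D e) ∧
        (∀ e, x e = 0 → 0 ≤ D e) ∧ (∀ e, x e = 1 → D e ≤ 0) ∧ ∑ e, |D e| = 1} := by
      ext D
      exact ⟨fun h => ⟨h.1.1, h.1.2, h.1.3, h.1.4, h.2⟩,
        fun h => ⟨⟨h.1, h.2.1, h.2.2.1, h.2.2.2.1⟩, h.2.2.2.2⟩⟩
    rw [this]
    simp only [Set.ofPred_and, Set.ofPred_forall]
    refine IsClosed.inter ?_ (IsClosed.inter ?_ (IsClosed.inter ?_ (IsClosed.inter ?_ ?_)))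
    · exact isClosed_iInter fun v => isClosed_iInter fun _ =>
        isClosed_eq (by fun_prop) continuous_const
    · exact isClosed_iInter fun v => isClosed_iInter fun _ => isClosed_iInter fun _ =>
        isClosed_le continuous_const (by fun_prop)
    · exact isClosed_iInter fun e => isClosed_iInter fun _ =>
        isClosed_le continuous_const (by fun_prop)
    · exact isClosed_iInter fun e => isClosed_iInter fun _ =>
        isClosed_le (by fun_prop) continuous_const
    · exact isClosed_eq (by fun_prop) continuous_const
  have hS : IsCompact S := by
    refine (isCompact_closedBall (0 : E → ℝ) 1).of_isClosed_subset hclosed fun D hD => ?_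
    rw [mem_closedBall_zero_iff, pi_norm_le_iff_of_nonneg zero_le_one]
    intro e
    rw [← hD.2]
    exact Finset.single_le_sum (f := fun e => |D e|) (fun _ _ => abs_nonneg _)
      (Finset.mem_univ e)
  obtain ⟨δ, hδ, hmin⟩ : ∃ δ : ℝ, 0 < δ ∧ ∀ D ∈ S, δ ≤ ∑ e, w e * D e := by
    rcases S.eq_empty_or_nonempty with h | h
    · exact ⟨1, one_pos, by simp [h]⟩
    · obtain ⟨D, hD, hm⟩ := hS.exists_isMinOn h
        (f := fun D => ∑ e, w e * D e) (by fun_prop)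
      refine ⟨_, hx.pos_of_isFeasibleDirection hD.1 ?_, fun D' hD' => hm hD'⟩
      rintro rfl
      simpa using hD.2
  refine ⟨δ, hδ, fun y hy => ?_⟩
  have hdir := hx.1.1.isFeasibleDirection_sub hy
  rcases (Finset.sum_nonneg fun e _ => abs_nonneg (y e - x e) :
    0 ≤ ∑ e, |y e - x e|).eq_or_lt with h0 | hpos
  · have : ∀ e, y e - x e = 0 := fun e => by
      have := (Finset.sum_eq_zero_iff_of_nonneg fun e _ => abs_nonneg (y e - x e)).1 h0.symm e
        (Finset.mem_univ e)
      simpa using this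
    simp [this]
  · set N := ∑ e, |y e - x e| with hN
    have hmem : N⁻¹ • (y - x) ∈ S := by
      refine ⟨hdir.smul (inv_nonneg.2 hpos.le), ?_⟩
      simp only [Pi.smul_apply, Pi.sub_apply, smul_eq_mul, abs_mul, ← Finset.mul_sum,
        abs_inv, abs_of_pos hpos]
      rw [← hN, inv_mul_cancel₀ hpos.ne']
    have h := hmin _ hmem
    have hs : ∑ e, w e * (N⁻¹ • (y - x)) e = N⁻¹ * ∑ e, w e * (y e - x e) := by
      rw [Finset.mul_sum]
      exact Finset.sum_congr rfl fun e _ => by simp; ring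
    rw [hs, inv_mul_eq_div, le_div_iff₀ hpos] at h
    exact h

/-! ### Strictly complementary dual solutions -/

/-- If a `0/1` vector `x` is the only optimal solution, some dual solution `l` satisfies strict
complementary slackness at every edge. The weights admitting such an `l` form an open convex cone.
If `w` lies outside it, a separating functional is, up to sign, a feasible direction at `x` along
which the cost does not increase. -/
theorem IsUniqueSolution.exists_strict_dual [Fintype V] (hx : G.IsUniqueSolution B d w x)
    (h01 : ∀ e, x e = 0 ∨ x e = 1) :
    ∃ l : V → ℝ, (∀ v ∈ B, 0 ≤ l v) ∧ (∀ v ∈ B, ∑ e ∈ G.delta v, x e ≠ d → l v = 0) ∧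
      ∀ e, 0 < (1 - 2 * x e) * (w e - ∑ v with v ∈ G.ends e, l v) := by
  let s : E → ℝ := fun e => 1 - 2 * x e
  have hs : ∀ e, s e * s e = 1 := fun e => by rcases h01 e with h | h <;> simp [s, h]; norm_num
  let A : (V → ℝ) → E → ℝ := fun l e => ∑ v with v ∈ G.ends e, l v
  let Λ : Set (V → ℝ) :=
    {l | (∀ v ∈ B, 0 ≤ l v) ∧ (∀ v ∈ B, ∑ e ∈ G.delta v, x e ≠ d → l v = 0)}
  let K : Set (E → ℝ) := {a | ∃ l ∈ Λ, ∀ e, 0 < s e * (a e - A l e)}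
  by_contra hcon
  have hwK : w ∉ K := fun ⟨l, hl, h⟩ => hcon ⟨l, hl.1, hl.2, h⟩
  have hAadd : ∀ (p q : ℝ) (l m : V → ℝ) e, A (p • l + q • m) e = p * A l e + q * A m e := by
    intro p q l m e
    simp [A, Finset.sum_add_distrib, Finset.mul_sum]
  have hcomb : ∀ (p q : ℝ), 0 ≤ p → 0 ≤ q → ∀ l ∈ Λ, ∀ m ∈ Λ, p • l + q • m ∈ Λ := by
    intro p q hp hq l hl m hm
    refine ⟨fun v hv => ?_, fun v hv h => ?_⟩
    · have h1 := mul_nonneg hp (hl.1 v hv)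
      have h2 := mul_nonneg hq (hm.1 v hv)
      simpa using add_nonneg h1 h2
    · simp [hl.2 v hv h, hm.2 v hv h]
  have hconv : Convex ℝ K := by
    rintro a ⟨l, hl, hla⟩ b ⟨m, hm, hmb⟩ p q hp hq hpq
    refine ⟨p • l + q • m, hcomb p q hp hq l hl m hm, fun e => ?_⟩
    rw [hAadd]
    have : s e * ((p • a + q • b) e - (p * A l e + q * A m e)) =
        p * (s e * (a e - A l e)) + q * (s e * (b e - A m e)) := by
      simp only [Pi.add_apply, Pi.smul_apply, smul_eq_mul]; ring
    rw [this]
    rcases hp.eq_or_lt with rfl | hp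
    · have : q = 1 := by linarith
      simpa [this] using hmb e
    · exact add_pos_of_pos_of_nonneg (mul_pos hp (hla e)) (mul_nonneg hq (hmb e).le)
  have hopen : IsOpen K := by
    have : K = ⋃ l ∈ Λ, ⋂ e, {a : E → ℝ | 0 < s e * (a e - A l e)} := by
      ext a; simp [K]
    rw [this]
    exact isOpen_biUnion fun l _ => isOpen_iInter_of_finite fun e =>
      isOpen_lt continuous_const (by fun_prop)
  obtain ⟨f, hf⟩ := geometric_hahn_banach_open_point hconv hopen hwK
  have hcone : ∀ a ∈ K, ∀ t : ℝ, 0 < t → t * f a < f w := by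
    rintro a ⟨l, hl, h⟩ t ht
    have hmem : t • a ∈ K := by
      refine ⟨t • l, by simpa using hcomb t 0 ht.le le_rfl l hl l hl, fun e => ?_⟩
      have hA := hAadd t 0 l l e
      simp only [zero_smul, add_zero, zero_mul] at hA
      rw [hA]
      have : s e * ((t • a) e - t * A l e) = t * (s e * (a e - A l e)) := by
        simp only [Pi.smul_apply, smul_eq_mul]; ring
      rw [this]
      exact mul_pos ht (h e)
    simpa using hf _ hmem
  have hΛ0 : (0 : V → ℝ) ∈ Λ := ⟨by simp, by simp⟩
  have hA0 : ∀ e, A 0 e = 0 := by simp [A]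
  have hsK : s ∈ K := ⟨0, hΛ0, fun e => by simp [hA0, hs]⟩
  have hnonpos : ∀ a ∈ K, f a ≤ 0 := by
    intro a ha
    by_contra! hpos
    have hw : 0 < f w := hpos.trans (hf a ha)
    have := hcone a ha (f w / f a) (by positivity)
    rw [div_mul_cancel₀ _ hpos.ne'] at this
    exact lt_irrefl _ this
  have hfw : 0 ≤ f w := by
    by_contra! hneg
    have h1 := hf s hsK
    have := hcone s hsK (f w / f s) (div_pos_of_neg_of_neg hneg (h1.trans hneg))
    rw [div_mul_cancel₀ _ (h1.trans hneg).ne] at this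
    exact lt_irrefl _ this
  -- Perturbing by multiples of `s` extends the sign of `f` from `K` to the closed cone.
  have hclosure : ∀ l ∈ Λ, ∀ a : E → ℝ, (∀ e, 0 ≤ s e * (a e - A l e)) → f a ≤ 0 := by
    intro l hl a ha
    have h1 : ∀ t : ℝ, 0 < t → f a + t * f s ≤ 0 := by
      intro t ht
      have : a + t • s ∈ K := by
        refine ⟨l, hl, fun e => ?_⟩
        have : s e * ((a + t • s) e - A l e) = s e * (a e - A l e) + t * (s e * s e) := by
          simp only [Pi.add_apply, Pi.smul_apply, smul_eq_mul]; ring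
        rw [this, hs]
        linarith [ha e]
      simpa using hnonpos _ this
    have hcont : Filter.Tendsto (fun t : ℝ => f a + t * f s) (nhdsWithin 0 (Set.Ioi 0))
        (nhds (f a)) := by
      have : ContinuousAt (fun t : ℝ => f a + t * f s) 0 := by fun_prop
      simpa using this.tendsto.mono_left nhdsWithin_le_nhds
    exact le_of_tendsto hcont (Filter.eventually_of_mem self_mem_nhdsWithin h1)
  let D : E → ℝ := fun e => -f (Pi.single e 1)
  have hfD : ∀ a, ∑ e, a e * D e = -f a := by
    intro a
    conv_rhs => rw [pi_eq_sum_univ' a]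
    simp [D, map_sum]
  have hfδ : ∀ (c : ℝ) v, Pi.single v c ∈ Λ → 0 ≤ c * ∑ e ∈ G.delta v, D e := by
    intro c v hmem
    have h1 := hclosure _ hmem (A (Pi.single v c)) (by simp)
    have h2 := hfD (A (Pi.single v c))
    have h3 : ∑ e, A (Pi.single v c) e * D e = c * ∑ e ∈ G.delta v, D e := by
      simp only [A, Finset.mul_sum, delta, Finset.sum_filter]
      refine Finset.sum_congr rfl fun e _ => ?_
      simp [Pi.single_apply]
      rw [Finset.sum_eq_single v] <;> simp +contextual
    linarith
  have hsD : ∀ e, 0 ≤ s e * D e := by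
    intro e
    have h1 := hclosure 0 hΛ0 (Pi.single e (s e)) (fun e' => by
      rw [hA0, sub_zero]
      by_cases h : e' = e
      · subst h; simp [hs]
      · simp [h])
    have h2 := hfD (Pi.single e (s e))
    have h3 : ∑ e', (Pi.single e (s e) : E → ℝ) e' * D e' = s e * D e := by
      simp [Pi.single_apply]
    linarith
  have hdir : G.IsFeasibleDirection B d x D := by
    constructor
    · intro v hv
      have hmem : ∀ c : ℝ, Pi.single v c ∈ Λ := fun c =>
        ⟨fun u hu => by rw [Pi.single_eq_of_ne (by rintro rfl; exact hv hu)],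
          fun u hu _ => by rw [Pi.single_eq_of_ne (by rintro rfl; exact hv hu)]⟩
      have h1 := hfδ 1 v (hmem 1)
      have h2 := hfδ (-1) v (hmem (-1))
      linarith
    · intro v hv ht
      have hmem : Pi.single v (1 : ℝ) ∈ Λ := by
        refine ⟨fun u hu => ?_, fun u hu h => ?_⟩
        · by_cases h : u = v
          · subst h; simp
          · simp [h]
        · rw [Pi.single_eq_of_ne (by rintro rfl; exact h ht)]
      simpa using hfδ 1 v hmem
    · intro e he
      simpa [s, he] using hsD e
    · intro e he
      have := hsD e
      simp only [s, he] at this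
      linarith
  have hD0 : D ≠ 0 := by
    intro h
    have h1 := hfD s
    have h2 := hfD w
    have h3 := hf s hsK
    simp only [h, Pi.zero_apply, mul_zero, Finset.sum_const_zero] at h1 h2
    linarith
  have h1 := hx.pos_of_isFeasibleDirection hdir hD0
  linarith [hfD w]

end Multigraph

/-! ### Max-product at a single degree constraint -/

/-- The degree constraint of the graphical model at a vertex: equality, or `≥` at a blossom. -/
def DegreeOK {ι : Type*} [Fintype ι] (b : Prop) (d : ℕ) (z : ι → Fin 2) : Prop :=
  (¬ b ∧ ∑ e, (z e : ℕ) = d) ∨ (b ∧ d ≤ ∑ e, (z e : ℕ))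

/-- The sign `1` at value `0` and `-1` at value `1`. -/
def sgn (c : Fin 2) : ℝ := 1 - 2 * ((c : ℕ) : ℝ)

theorem sgn_add_one (c : Fin 2) : sgn (c + 1) = - sgn c := by
  fin_cases c <;> norm_num [sgn]

theorem Fin2.eq_add_one_of_ne {a b : Fin 2} (h : a ≠ b) : a = b + 1 := by
  revert a b; decide

section Local

variable {ι : Type*} [Fintype ι] [DecidableEq ι] {b : Prop} {d : ℕ} {X z : ι → Fin 2} {i : ι}

theorem sum_update (z : ι → Fin 2) (i : ι) (c : Fin 2) :
    ∑ e, (Function.update z i c e : ℕ) + (z i : ℕ) = ∑ e, (z e : ℕ) + (c : ℕ) := by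
  rw [← Finset.add_sum_erase _ _ (Finset.mem_univ i),
    ← Finset.add_sum_erase _ (fun e => (z e : ℕ)) (Finset.mem_univ i)]
  rw [Finset.sum_congr rfl (g := fun e => (z e : ℕ)) fun e he => by
    rw [Function.update_of_ne (Finset.ne_of_mem_erase he)]]
  simp
  omega

/-- Exchange property: a feasible local assignment `z` that is wrong at `i` can be moved towards
the feasible `X` at `i`, either together with an oppositely signed coordinate `j`, or alone. In the
latter case the vertex is a blossom, and its constraint has slack at `X` when `X i = 1`. -/
theorem DegreeOK.exchange (hX : DegreeOK b d X) (hz : DegreeOK b d z) (hi : z i = X i + 1) :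
    (∃ j, j ≠ i ∧ X j = X i + 1 ∧ z j = X j + 1 ∧
      DegreeOK b d (Function.update (Function.update z i (X i)) j (X j))) ∨
    (b ∧ (X i = 1 → ∑ e, (X e : ℕ) ≠ d) ∧ DegreeOK b d (Function.update z i (X i))) := by
  by_cases h : ∃ j, X j = X i + 1 ∧ z j = X j + 1
  · obtain ⟨j, hj, hzj⟩ := h
    have hji : j ≠ i := by
      rintro rfl
      revert hj; generalize X j = c; revert c; decide
    refine Or.inl ⟨j, hji, hj, hzj, ?_⟩
    have h1 := sum_update z i (X i)
    have h2 := sum_update (Function.update z i (X i)) j (X j)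
    rw [Function.update_of_ne hji] at h2
    have h3 : (X j : ℕ) + X i = z j + z i := by
      rw [hzj, hi, hj]; generalize X i = c; revert c; decide
    have : ∑ e, (Function.update (Function.update z i (X i)) j (X j) e : ℕ) = ∑ e, (z e : ℕ) := by
      omega
    unfold DegreeOK at hz ⊢
    rwa [this]
  · right
    push Not at h
    have h1 := sum_update z i (X i)
    have hcase : ∀ c : Fin 2, c = 0 ∨ c = 1 := by decide
    have hne : ∀ j, X j = X i + 1 → z j = X j := fun j hj => by
      by_contra hzj; exact h j hj (Fin2.eq_add_one_of_ne hzj)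
    rcases hcase (X i) with h0 | h0
    · have hlt : ∑ e, (X e : ℕ) < ∑ e, (z e : ℕ) := by
        refine Finset.sum_lt_sum (fun j _ => ?_) ⟨i, Finset.mem_univ i, by simp [hi, h0]⟩
        rcases hcase (X j) with hj | hj
        · simp [hj]
        · rw [hne j (by simp [hj, h0])]
      rw [hi, h0] at h1
      simp only [zero_add, Fin.val_one, Fin.val_zero, add_zero] at h1
      rw [h0]
      rcases hX with ⟨hb, hX⟩ | ⟨hb, hX⟩ <;> rcases hz with ⟨hb', hz⟩ | ⟨hb', hz⟩
      · omega
      · exact absurd hb' hb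
      · exact absurd hb hb'
      · exact ⟨hb, by simp, Or.inr ⟨hb, by omega⟩⟩
    · have hlt : ∑ e, (z e : ℕ) < ∑ e, (X e : ℕ) := by
        refine Finset.sum_lt_sum (fun j _ => ?_) ⟨i, Finset.mem_univ i, by simp [hi, h0]⟩
        rcases hcase (X j) with hj | hj
        · rw [hne j (by simp [hj, h0])]
        · rw [hj]; simp; omega
      rw [hi, h0] at h1
      simp at h1
      rw [h0]
      rcases hX with ⟨hb, hX⟩ | ⟨hb, hX⟩ <;> rcases hz with ⟨hb', hz⟩ | ⟨hb', hz⟩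
      · omega
      · exact absurd hb' hb
      · exact absurd hb hb'
      · exact ⟨hb, fun _ => by omega, Or.inr ⟨hb, by omega⟩⟩

/-- One relaxation of the message ratios at a constraint with potential `l`: if every incoming
ratio is at least `exp (r + sgn (X j) * l)` in favour of `X`, every outgoing one is at least
`exp (min 0 r - sgn (X i) * l)` in favour of `X`. -/
theorem DegreeOK.prod_le {l r : ℝ} {μ : ι → Fin 2 → ℝ} (hX : DegreeOK b d X)
    (hz : DegreeOK b d z) (hi : z i = X i + 1) (hl : b → 0 ≤ l)
    (hl0 : b → ∑ e, (X e : ℕ) ≠ d → l = 0) (hμ0 : ∀ j c, 0 ≤ μ j c)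
    (hμ : ∀ j, μ j (X j + 1) ≤ Real.exp (-(r + sgn (X j) * l)) * μ j (X j)) :
    ∃ z', DegreeOK b d z' ∧ z' i = X i ∧
      ∏ j ∈ Finset.univ.erase i, μ j (z j) ≤
        Real.exp (-(min 0 r - sgn (X i) * l)) * ∏ j ∈ Finset.univ.erase i, μ j (z' j) := by
  rcases hX.exchange hz hi with ⟨j, hji, hXj, hzj, hok⟩ | ⟨hb, hslack, hok⟩
  · refine ⟨_, hok, by simp [Function.update_of_ne hji.symm], ?_⟩
    have hj : j ∈ Finset.univ.erase i := by simp [hji]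
    rw [← Finset.mul_prod_erase _ _ hj, ← Finset.mul_prod_erase _ _ hj, ← mul_assoc]
    have hrest : ∏ k ∈ (Finset.univ.erase i).erase j,
        μ k (Function.update (Function.update z i (X i)) j (X j) k) =
        ∏ k ∈ (Finset.univ.erase i).erase j, μ k (z k) := by
      refine Finset.prod_congr rfl fun k hk => ?_
      rw [Function.update_of_ne (Finset.ne_of_mem_erase hk),
        Function.update_of_ne (Finset.ne_of_mem_erase (Finset.mem_of_mem_erase hk))]
    rw [hrest, Function.update_self, hzj]
    refine mul_le_mul_of_nonneg_right ((hμ j).trans ?_) (Finset.prod_nonneg fun k _ => hμ0 _ _)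
    refine mul_le_mul_of_nonneg_right (Real.exp_le_exp.2 ?_) (hμ0 _ _)
    rw [hXj, sgn_add_one]
    linarith [min_le_right 0 r]
  · refine ⟨_, hok, by simp, ?_⟩
    have hrest : ∏ k ∈ Finset.univ.erase i, μ k (Function.update z i (X i) k) =
        ∏ k ∈ Finset.univ.erase i, μ k (z k) :=
      Finset.prod_congr rfl fun k hk => by
        rw [Function.update_of_ne (Finset.ne_of_mem_erase hk)]
    rw [hrest]
    refine le_mul_of_one_le_left (Finset.prod_nonneg fun k _ => hμ0 _ _) (Real.one_le_exp ?_)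
    have hsl : 0 ≤ sgn (X i) * l := by
      have hcase : ∀ c : Fin 2, c = 0 ∨ c = 1 := by decide
      rcases hcase (X i) with h0 | h0
      · simpa [h0, sgn] using hl hb
      · simp [hl0 hb (hslack h0)]
    linarith [min_le_left 0 r]

end Local

/-! ### Convergence of max-product belief propagation -/

namespace Multigraph

open GraphicalModel

variable {V E : Type*} [Fintype V] [Fintype E] {G : Multigraph V E} {B : Set V} {d : ℕ}
  {w : E → ℝ} {X : E → Fin 2} {l : V → ℝ}

omit [Fintype E] in
theorem card_ends_le_two (e : E) : (Finset.univ.filter (· ∈ G.ends e)).card ≤ 2 := by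
  induction h : G.ends e using Sym2.ind with
  | _ u v =>
    refine (Finset.card_le_card (t := {u, v}) fun a ha => ?_).trans Finset.card_le_two
    simpa using ha

/-- The sum of the dual variables at the ends of an edge. -/
noncomputable def endSum (G : Multigraph V E) (l : V → ℝ) (e : E) : ℝ := ∑ v with v ∈ G.ends e, l v

/-- Messages are nonnegative, and positive at the value prescribed by `X`. -/
structure GoodMessages (X : E → Fin 2) (m : (G.degreeGM B d w).Messages) : Prop where
  toVar_nonneg : ∀ v e c, 0 ≤ m.toVar v e c
  toFactor_nonneg : ∀ v e c, 0 ≤ m.toFactor v e c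
  toVar_pos : ∀ v e, 0 < m.toVar v e (X e)
  toFactor_pos : ∀ v e, 0 < m.toFactor v e (X e)

/-- After shifting by the potentials `l`, the log-ratios of the messages in favour of `X` are at
least `r` (from vertices to edges) and at least `q` (from edges to vertices). -/
structure RatioBound (X : E → Fin 2) (l : V → ℝ) (r q : ℝ) (m : (G.degreeGM B d w).Messages) :
    Prop where
  toVar_le : ∀ v e, m.toVar v e (X e + 1) ≤
    Real.exp (-(r - sgn (X e) * l v)) * m.toVar v e (X e)
  toFactor_le : ∀ v e, m.toFactor v e (X e + 1) ≤
    Real.exp (-(q + sgn (X e) * l v)) * m.toFactor v e (X e)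

omit [Fintype V] in
theorem factor_eq_one {v : V} {z : G.delta v → Fin 2} (h : DegreeOK (v ∈ B) d z) :
    (G.degreeGM B d w).factor v z = 1 := if_pos h

omit [Fintype V] in
theorem factor_eq_zero {v : V} {z : G.delta v → Fin 2} (h : ¬ DegreeOK (v ∈ B) d z) :
    (G.degreeGM B d w).factor v z = 0 := if_neg h

theorem le_step_toVar (m : (G.degreeGM B d w).Messages) (v : V) (e : G.delta v)
    {z : G.delta v → Fin 2} (hz : DegreeOK (v ∈ B) d z) :
    ∏ j ∈ Finset.univ.erase e, m.toFactor v j (z j) ≤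
      ((G.degreeGM B d w).step m).toVar v e (z e) := by
  have h := le_ciSup (f := fun y : {y : G.delta v → Fin 2 // y e = z e} =>
    (G.degreeGM B d w).factor v y.1 * ∏ j ∈ Finset.univ.erase e, m.toFactor v j (y.1 j))
    (Set.finite_range _).bddAbove ⟨z, rfl⟩
  rw [factor_eq_one hz, one_mul] at h
  exact h

theorem GoodMessages.step {m : (G.degreeGM B d w).Messages} (hm : GoodMessages X m)
    (hX : ∀ v, DegreeOK (v ∈ B) d fun e : G.delta v => X e) :
    GoodMessages X ((G.degreeGM B d w).step m) where
  toVar_nonneg _ _ _ := Real.iSup_nonneg fun _ =>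
    mul_nonneg ((G.degreeGM B d w).factor_nonneg _ _)
      (Finset.prod_nonneg fun _ _ => hm.toFactor_nonneg _ _ _)
  toFactor_nonneg _ _ _ := mul_nonneg ((G.degreeGM B d w).varFactor_nonneg _ _)
    (Finset.prod_nonneg fun _ _ => hm.toVar_nonneg _ _ _)
  toVar_pos v e := lt_of_lt_of_le (Finset.prod_pos fun j _ => hm.toFactor_pos v j)
    (le_step_toVar m v e (hX v))
  toFactor_pos _ _ := mul_pos (Real.exp_pos _) (Finset.prod_pos fun b _ => hm.toVar_pos b.1 _)

omit [Fintype V] in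
theorem varFactor_add_one (e : E) (c : Fin 2) :
    (G.degreeGM B d w).varFactor e (c + 1) =
      Real.exp (-(sgn c * w e)) * (G.degreeGM B d w).varFactor e c := by
  simp only [degreeGM, ← Real.exp_add]
  congr 1
  fin_cases c <;> norm_num [sgn]

/-- Incoming vertex messages over a set of vertices, multiplied together. -/
theorem RatioBound.prod_toVar_le {m : (G.degreeGM B d w).Messages} {r q : ℝ}
    (hm : GoodMessages X m) (hr : RatioBound X l r q m) (e : E) (p : V → Prop)
    [DecidablePred p] [Fintype {v // p v}] (hp : ∀ v, p v → e ∈ (G.degreeGM B d w).scope v) :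
    ∏ v : {v // p v}, m.toVar v.1 ⟨e, hp v.1 v.2⟩ (X e + 1) ≤
      Real.exp (-∑ v with p v, (r - sgn (X e) * l v)) *
        ∏ v : {v // p v}, m.toVar v.1 ⟨e, hp v.1 v.2⟩ (X e) := by
  refine (Finset.prod_le_prod (fun v _ => hm.toVar_nonneg _ _ _)
    fun v _ => hr.toVar_le v.1 ⟨e, hp v.1 v.2⟩).trans_eq ?_
  rw [Finset.prod_mul_distrib, ← Real.exp_sum, Finset.sum_neg_distrib,
    Finset.sum_subtype (Finset.univ.filter p) (p := p) (by simp)]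

/-- One parallel update improves the shifted log-ratios by the reduced cost bound `δ`. -/
theorem RatioBound.step {m : (G.degreeGM B d w).Messages} {r q δ : ℝ}
    (hX : ∀ v, DegreeOK (v ∈ B) d fun e : G.delta v => X e)
    (hl : ∀ v ∈ B, 0 ≤ l v) (hl0 : ∀ v ∈ B, ∑ e : G.delta v, (X e : ℕ) ≠ d → l v = 0)
    (hδ : ∀ e, δ ≤ sgn (X e) * (w e - G.endSum l e))
    (hm : GoodMessages X m) (hr : RatioBound X l r q m) (hr0 : r ≤ 0) :
    RatioBound X l (min 0 q) (r + δ) ((G.degreeGM B d w).step m) where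
  toVar_le v e := by
    refine Real.iSup_le (fun z => ?_)
      (mul_nonneg (Real.exp_pos _).le ((hm.step hX).toVar_nonneg _ _ _))
    by_cases hz : DegreeOK (v ∈ B) d z.1
    · obtain ⟨z', hz', hi, hle⟩ := (hX v).prod_le (μ := m.toFactor v) (l := l v) (r := q) hz
        z.2 (hl v) (hl0 v) (hm.toFactor_nonneg v) (hr.toFactor_le v)
      rw [factor_eq_one hz, one_mul]
      refine hle.trans (mul_le_mul_of_nonneg_left ?_ (Real.exp_pos _).le)
      have h := le_step_toVar m v e hz'
      rwa [hi] at h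
    · rw [factor_eq_zero hz, zero_mul]
      exact mul_nonneg (Real.exp_pos _).le ((hm.step hX).toVar_nonneg _ _ _)
  toFactor_le v e := by
    have hprod := hr.prod_toVar_le hm e (fun b => b ≠ v ∧ (e : E) ∈ G.delta b) fun b hb => hb.2
    have hsum : r + δ + sgn (X e) * l v ≤
        sgn (X e) * w e +
          ∑ b with b ≠ v ∧ (e : E) ∈ G.delta b, (r - sgn (X e) * l b) := by
      have hv : v ∈ Finset.univ.filter (· ∈ G.ends (e : E)) := by
        simpa using mem_delta.1 e.2
      have hset : Finset.univ.filter (fun b => b ≠ v ∧ (e : E) ∈ G.delta b) =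
          (Finset.univ.filter (· ∈ G.ends (e : E))).erase v := by
        ext b; simp [mem_delta]
      have hcard : ((Finset.univ.filter (· ∈ G.ends (e : E))).erase v).card ≤ 1 := by
        rw [Finset.card_erase_of_mem hv]
        have := G.card_ends_le_two (e : E)
        omega
      have hend := Finset.add_sum_erase _ l hv
      rw [hset, Finset.sum_sub_distrib, Finset.sum_const, nsmul_eq_mul, ← Finset.mul_sum]
      -- At most one end other than `v` contributes, and `r ≤ 0`.
      have h1 : r ≤ (((Finset.univ.filter (· ∈ G.ends (e : E))).erase v).card : ℝ) * r := by
        have : (((Finset.univ.filter (· ∈ G.ends (e : E))).erase v).card : ℝ) ≤ 1 := by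
          exact_mod_cast hcard
        nlinarith
      have h2 := hδ e
      rw [endSum, ← hend] at h2
      linarith
    refine (mul_le_mul_of_nonneg_left hprod
      ((G.degreeGM B d w).varFactor_nonneg e (X e + 1))).trans ?_
    rw [varFactor_add_one]
    have hnn : 0 ≤ ((G.degreeGM B d w).step m).toFactor v e (X e) :=
      (hm.step hX).toFactor_nonneg _ _ _
    refine le_trans (le_of_eq ?_) (mul_le_mul_of_nonneg_right
      (Real.exp_le_exp.2 (neg_le_neg hsum)) hnn)
    rw [neg_add, Real.exp_add]
    exact mul_mul_mul_comm _ _ _ _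

/-- With nonnegative shifted log-ratios, the beliefs single out `X`. -/
theorem RatioBound.belief_lt {m : (G.degreeGM B d w).Messages} {q δ : ℝ} (hδ0 : 0 < δ)
    (hδ : ∀ e, δ ≤ sgn (X e) * (w e - G.endSum l e))
    (hm : GoodMessages X m) (hr : RatioBound X l 0 q m) (e : E) :
    (G.degreeGM B d w).belief m e (X e + 1) < (G.degreeGM B d w).belief m e (X e) := by
  have hprod := hr.prod_toVar_le hm e (fun b => e ∈ G.delta b) fun b hb => hb
  have hpos : 0 < (G.degreeGM B d w).belief m e (X e) :=
    mul_pos (Real.exp_pos _) (Finset.prod_pos fun b _ => hm.toVar_pos b.1 ⟨e, b.2⟩)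
  refine (mul_le_mul_of_nonneg_left hprod
    ((G.degreeGM B d w).varFactor_nonneg e (X e + 1))).trans_lt ?_
  have hset : ∑ b with e ∈ G.delta b, (0 - sgn (X e) * l b) = -(sgn (X e) * G.endSum l e) := by
    simp [endSum, Finset.mul_sum, mem_delta]
  have hexp : Real.exp (-(sgn (X e) * (w e - G.endSum l e))) < 1 :=
    Real.exp_lt_one_iff.2 (by linarith [hδ e])
  rw [hset, varFactor_add_one]
  refine lt_of_eq_of_lt ?_ (mul_lt_of_lt_one_left hpos hexp)
  rw [mul_sub, neg_sub, sub_eq_neg_add, Real.exp_add, neg_neg]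
  exact mul_mul_mul_comm _ _ _ _

theorem output_eq_some {m : (G.degreeGM B d w).Messages} {e : E} {c : Fin 2}
    (h : (G.degreeGM B d w).belief m e (c + 1) < (G.degreeGM B d w).belief m e c) :
    (G.degreeGM B d w).output m e = some c := by
  have hcase : ∀ c : Fin 2, c = 0 ∨ c = 1 := by decide
  unfold GraphicalModel.output
  rcases hcase c with rfl | rfl
  · rw [zero_add] at h
    rw [if_neg h.not_gt, if_pos h]
  · rw [if_pos (by simpa using h)]

/-- Positive messages satisfy the ratio bounds for some real `r`, since there are only finitely
many of them. -/
theorem exists_ratioBound {m : (G.degreeGM B d w).Messages} (hm : m.Positive) (δ : ℝ) :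
    ∃ r : ℝ, r ≤ 0 ∧ RatioBound X l r (r + δ) m := by
  have hev : ∀ (a b s : ℝ), 0 < b → ∀ᶠ r in Filter.atBot, a ≤ Real.exp (-(r + s)) * b := by
    intro a b s hb
    have : Filter.Tendsto (fun r : ℝ => Real.exp (-(r + s)) * b) Filter.atBot Filter.atTop :=
      (Real.tendsto_exp_atTop.comp (Filter.tendsto_neg_atBot_atTop.comp
        (Filter.tendsto_atBot_add_const_right _ s Filter.tendsto_id))).atTop_mul_const hb
    exact this.eventually_ge_atTop a
  have h1 : ∀ᶠ r in Filter.atBot, ∀ v (e : G.delta v), m.toVar v e (X e + 1) ≤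
      Real.exp (-(r + -(sgn (X e) * l v))) * m.toVar v e (X e) :=
    Filter.eventually_all.2 fun v => Filter.eventually_all.2 fun e => hev _ _ _ (hm v e _).1
  have h2 : ∀ᶠ r in Filter.atBot, ∀ v (e : G.delta v), m.toFactor v e (X e + 1) ≤
      Real.exp (-(r + (δ + sgn (X e) * l v))) * m.toFactor v e (X e) :=
    Filter.eventually_all.2 fun v => Filter.eventually_all.2 fun e => hev _ _ _ (hm v e _).2
  obtain ⟨r, h0, h1, h2⟩ := ((Filter.eventually_le_atBot (0 : ℝ)).and (h1.and h2)).exists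
  exact ⟨r, h0, fun v e => by simpa [sub_eq_add_neg] using h1 v e,
    fun v e => by simpa [add_assoc] using h2 v e⟩

omit [Fintype V] in
theorem RatioBound.mono {m : (G.degreeGM B d w).Messages} {r r' q q' : ℝ}
    (hm : GoodMessages X m) (h : RatioBound X l r q m) (hr : r' ≤ r) (hq : q' ≤ q) :
    RatioBound X l r' q' m where
  toVar_le v e := (h.toVar_le v e).trans (mul_le_mul_of_nonneg_right
    (Real.exp_le_exp.2 (by linarith)) (hm.toVar_nonneg _ _ _))
  toFactor_le v e := (h.toFactor_le v e).trans (mul_le_mul_of_nonneg_right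
    (Real.exp_le_exp.2 (by linarith)) (hm.toFactor_nonneg _ _ _))

/-- Belief propagation converges to a `0/1` vector that is the only optimal solution. -/
theorem IsUniqueSolution.bpConvergesTo {x : E → ℝ} (hx : G.IsUniqueSolution B d w x)
    (h01 : ∀ e, x e = 0 ∨ x e = 1) (m₀ : (G.degreeGM B d w).Messages) (hm₀ : m₀.Positive) :
    (G.degreeGM B d w).BPConvergesTo m₀ x := by
  obtain ⟨l, hl, hl0, hpos⟩ := hx.exists_strict_dual h01
  let X : E → Fin 2 := fun e => if x e = 1 then 1 else 0
  have hxX : ∀ e, x e = ((X e : ℕ) : ℝ) := fun e => by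
    rcases h01 e with h | h <;> simp [X, h]
  have hsum : ∀ v, ∑ e ∈ G.delta v, x e = ((∑ e : G.delta v, (X e : ℕ) : ℕ) : ℝ) := fun v => by
    rw [Finset.sum_coe_sort (G.delta v) (fun e => (X e : ℕ)), Nat.cast_sum]
    exact Finset.sum_congr rfl fun e _ => hxX e
  have hX : ∀ v, DegreeOK (v ∈ B) d fun e : G.delta v => X e := fun v => by
    by_cases hv : v ∈ B
    · have := hx.1.1.2.1 v hv
      rw [hsum] at this
      exact Or.inr ⟨hv, by exact_mod_cast this⟩
    · have := hx.1.1.1 v hv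
      rw [hsum] at this
      exact Or.inl ⟨hv, by exact_mod_cast this⟩
  have hl0' : ∀ v ∈ B, ∑ e : G.delta v, (X e : ℕ) ≠ d → l v = 0 := fun v hv h =>
    hl0 v hv (by rw [hsum]; exact_mod_cast h)
  obtain ⟨δ, hδ0, hδ⟩ : ∃ δ : ℝ, 0 < δ ∧ ∀ e, δ ≤ sgn (X e) * (w e - G.endSum l e) := by
    have hev : ∀ᶠ δ in nhdsWithin (0 : ℝ) (Set.Ioi 0),
        ∀ e, δ ≤ sgn (X e) * (w e - G.endSum l e) :=
      Filter.eventually_all.2 fun e => by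
        have := hpos e
        rw [hxX e] at this
        exact (Filter.Eventually.filter_mono nhdsWithin_le_nhds (gt_mem_nhds this)).mono
          fun t ht => le_of_lt ht
    have h0 : ∀ᶠ t in nhdsWithin (0 : ℝ) (Set.Ioi 0), 0 < t := self_mem_nhdsWithin
    exact (h0.and hev).exists
  obtain ⟨r, hr0, hr⟩ := exists_ratioBound (X := X) (l := l) hm₀ (δ / 2)
  -- A round trip of two iterations gains `δ`. Keeping the edge bound `δ / 2` above the vertex bound
  -- spreads this gain evenly, so that the vertex bound rises by `δ / 2` per iteration up to `0`.
  have hinv : ∀ t, GoodMessages X ((G.degreeGM B d w).messages m₀ t) ∧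
      RatioBound X l (min 0 (r + t * (δ / 2))) (min 0 (r + t * (δ / 2)) + δ / 2)
        ((G.degreeGM B d w).messages m₀ t) := by
    intro t
    induction t with
    | zero =>
      refine ⟨⟨fun v e c => (hm₀ v e c).1.le, fun v e c => (hm₀ v e c).2.le,
        fun v e => (hm₀ v e _).1, fun v e => (hm₀ v e _).2⟩, ?_⟩
      simpa [messages, min_eq_right hr0] using hr
    | succ t ih =>
      obtain ⟨hg, hb⟩ := ih
      have hstep : (G.degreeGM B d w).messages m₀ (t + 1) =
          (G.degreeGM B d w).step ((G.degreeGM B d w).messages m₀ t) :=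
        Function.iterate_succ_apply' _ _ _
      rw [hstep]
      have hg' := hg.step hX
      refine ⟨hg', (hb.step hX hl hl0' hδ hg (min_le_left _ _)).mono hg' ?_ ?_⟩
      · push_cast
        refine le_min (min_le_left _ _) ?_
        rcases min_cases 0 (r + t * (δ / 2)) with h | h <;>
          rcases min_cases 0 (r + (t + 1) * (δ / 2)) with h' | h' <;> linarith
      · push_cast
        rcases min_cases 0 (r + t * (δ / 2)) with h | h <;>
          rcases min_cases 0 (r + (t + 1) * (δ / 2)) with h' | h' <;> linarith
  obtain ⟨T, hT⟩ := exists_nat_ge (-r / (δ / 2))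
  refine ⟨T, fun t ht e => ⟨X e, output_eq_some ?_, hxX e⟩⟩
  obtain ⟨hg, hb⟩ := hinv t
  have hnn : 0 ≤ r + t * (δ / 2) := by
    rw [div_le_iff₀ (by positivity)] at hT
    have : (T : ℝ) ≤ t := by exact_mod_cast ht
    nlinarith
  rw [min_eq_left hnn] at hb
  exact hb.belief_lt hδ0 hδ hg e

end Multigraph

/-! ### Half-integrality of a unique optimal solution -/

namespace Multigraph

variable {V E : Type*} [Fintype V] [Fintype E] {G : Multigraph V E} {B : Set V}
  {w x y : E → ℝ}

/-- A vector supported on the fractional edges of a unique optimal solution and with zero degree at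
all tight vertices vanishes, as both it and its negative are feasible directions. -/
theorem IsUniqueSolution.eq_zero_of_fractional {d : ℕ} (hy : G.IsUniqueSolution B d w y) {D : E → ℝ}
    (hD : ∀ e, y e = 0 ∨ y e = 1 → D e = 0)
    (hsum : ∀ v, ∑ e ∈ G.delta v, y e = d → ∑ e ∈ G.delta v, D e = 0) : D = 0 := by
  have hdir : ∀ D' : E → ℝ, (∀ e, y e = 0 ∨ y e = 1 → D' e = 0) →
      (∀ v, ∑ e ∈ G.delta v, y e = d → ∑ e ∈ G.delta v, D' e = 0) →
      G.IsFeasibleDirection B d y D' := fun D' h h' =>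
    ⟨fun v hv => h' v (hy.1.1.1 v hv), fun v _ ht => (h' v ht).ge, fun e he => (h e (Or.inl he)).ge,
      fun e he => (h e (Or.inr he)).le⟩
  by_contra h0
  have h1 := hy.pos_of_isFeasibleDirection (hdir D hD hsum) h0
  have h2 := hy.pos_of_isFeasibleDirection (D := -D)
    (hdir (-D) (fun e he => by simp [hD e he]) fun v hv => by simp [hsum v hv]) (neg_ne_zero.2 h0)
  simp only [Pi.neg_apply, mul_neg, Finset.sum_neg_distrib] at h2
  linarith

/-- The fractional edges at a unique optimal solution are linearly independent over the tight
vertices that they meet, so there are at most as many of them. Every such vertex meets at least two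
of them, and every edge has at most two ends, so every such vertex meets exactly two. Then
`y - 1/2` on the fractional edges has zero degree at every tight vertex, and it vanishes. -/
theorem IsUniqueSolution.halfIntegral (hy : G.IsUniqueSolution B 1 w y) : HalfIntegral y := by
  have hbox := hy.1.1.2.2
  let F : Finset E := {e | 0 < y e ∧ y e < 1}
  have hnF : ∀ e, e ∉ F → y e = 0 ∨ y e = 1 := by
    intro e he
    have : ¬ (0 < y e ∧ y e < 1) := by simpa [F] using he
    by_contra! h
    exact this ⟨lt_of_le_of_ne (hbox e).1 h.1.symm, lt_of_le_of_ne (hbox e).2 h.2⟩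
  let T : Finset V := {v | ∑ e ∈ G.delta v, y e = 1 ∧ (F.filter fun e => v ∈ G.ends e).Nonempty}
  have hsplit : ∀ v (D : E → ℝ), (∀ e, e ∉ F → D e = 0) →
      ∑ e ∈ G.delta v, D e = ∑ e ∈ F with v ∈ G.ends e, D e := by
    intro v D hD
    refine (Finset.sum_subset (fun e he => ?_) fun e he he' => hD e fun h => he' ?_).symm
    · exact mem_delta.2 (Finset.mem_filter.1 he).2
    · exact Finset.mem_filter.2 ⟨h, mem_delta.1 he⟩
  -- An edge of value `1` at `v` would leave no room for a fractional one.
  have hone : ∀ v ∈ T, ∑ e ∈ F with v ∈ G.ends e, y e = 1 := by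
    intro v hv
    obtain ⟨hsum, e₀, he₀⟩ := (Finset.mem_filter.1 hv).2
    obtain ⟨he₀F, he₀v⟩ := Finset.mem_filter.1 he₀
    have he₀y : 0 < y e₀ ∧ y e₀ < 1 := by simpa [F] using he₀F
    rw [← hsum]
    refine Finset.sum_subset (fun e he => mem_delta.2 (Finset.mem_filter.1 he).2)
      fun e he he' => ?_
    have heF : e ∉ F := fun h => he' (Finset.mem_filter.2 ⟨h, mem_delta.1 he⟩)
    refine (hnF e heF).resolve_right fun h1 => ?_
    have hne : e₀ ≠ e := fun h => heF (h ▸ he₀F)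
    have := Finset.add_le_sum (f := y) (s := G.delta v) (fun i _ => (hbox i).1)
      (mem_delta.2 he₀v) he hne
    linarith [he₀y.1]
  -- A single fractional value cannot sum to `1`.
  have hdeg : ∀ v ∈ T, 2 ≤ (F.filter fun e => v ∈ G.ends e).card := by
    intro v hv
    have h1 := hone v hv
    by_contra! hlt
    obtain ⟨e₀, he₀⟩ := (Finset.mem_filter.1 hv).2.2
    have hc : (F.filter fun e => v ∈ G.ends e).card = 1 := by
      have := Finset.card_pos.2 ⟨e₀, he₀⟩
      omega
    obtain ⟨e, he⟩ := Finset.card_eq_one.1 hc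
    have heF : e ∈ F := (Finset.mem_filter.1 (he ▸ Finset.mem_singleton_self e)).1
    have hey : 0 < y e ∧ y e < 1 := by simpa [F] using heF
    rw [he, Finset.sum_singleton] at h1
    linarith [hey.2]
  have hcard : F.card ≤ T.card := by
    let L : (F → ℝ) →ₗ[ℝ] (T → ℝ) :=
      { toFun := fun D v => ∑ e : F, if (v : V) ∈ G.ends e then D e else 0
        map_add' := fun D D' => by
          ext v
          simp only [Pi.add_apply, ← Finset.sum_add_distrib]
          exact Finset.sum_congr rfl fun e _ => by split_ifs <;> simp
        map_smul' := fun c D => by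
          ext v
          simp only [Pi.smul_apply, smul_eq_mul, RingHom.id_apply, Finset.mul_sum]
          exact Finset.sum_congr rfl fun e _ => by split_ifs <;> simp }
    have hL : Function.Injective L := by
      rw [injective_iff_map_eq_zero]
      intro D hD
      let D' : E → ℝ := fun e => if h : e ∈ F then D ⟨e, h⟩ else 0
      have hD'F : ∀ e, e ∉ F → D' e = 0 := fun e he => by simp [D', he]
      have hD' : D' = 0 := by
        refine hy.eq_zero_of_fractional (fun e he => hD'F e fun h => ?_) fun v hv => ?_
        · have : 0 < y e ∧ y e < 1 := by simpa [F] using h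
          rcases he with he | he <;> linarith [this.1, this.2]
        · rw [hsplit v D' hD'F]
          by_cases hne : (F.filter fun e => v ∈ G.ends e).Nonempty
          · have hvT : v ∈ T := by
              simp only [T, Finset.mem_filter, Finset.mem_univ, true_and]
              exact ⟨by simpa using hv, hne⟩
            have := congrFun hD ⟨v, hvT⟩
            rw [Finset.sum_filter, ← Finset.sum_coe_sort]
            simpa [L, D'] using this
          · rw [Finset.not_nonempty_iff_eq_empty.1 hne, Finset.sum_empty]
      ext e
      simpa [D'] using congrFun hD' (e : E)
    simpa using LinearMap.finrank_le_finrank_of_injective hL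
  have hcount : ∑ v ∈ T, (F.filter fun e => v ∈ G.ends e).card ≤ ∑ v ∈ T, 2 := by
    calc ∑ v ∈ T, (F.filter fun e => v ∈ G.ends e).card
        = ∑ e ∈ F, (T.filter fun v => v ∈ G.ends e).card :=
          Finset.sum_card_bipartiteAbove_eq_sum_card_bipartiteBelow _
      _ ≤ ∑ e ∈ F, 2 := Finset.sum_le_sum fun e _ =>
          (Finset.card_le_card (Finset.filter_subset_filter _ (Finset.subset_univ T))).trans
            (G.card_ends_le_two e)
      _ ≤ ∑ v ∈ T, 2 := by simpa using hcard
  have htwo : ∀ v ∈ T, 2 = (F.filter fun e => v ∈ G.ends e).card :=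
    (Finset.sum_eq_sum_iff_of_le hdeg).1 (le_antisymm (Finset.sum_le_sum hdeg) hcount)
  let D : E → ℝ := fun e => if e ∈ F then y e - 1 / 2 else 0
  have hDF : ∀ e, e ∉ F → D e = 0 := fun e he => by simp [D, he]
  have hD : D = 0 := by
    refine hy.eq_zero_of_fractional (fun e he => hDF e fun h => ?_) fun v hv => ?_
    · have : 0 < y e ∧ y e < 1 := by simpa [F] using h
      rcases he with he | he <;> linarith [this.1, this.2]
    · rw [hsplit v D hDF]
      by_cases hne : (F.filter fun e => v ∈ G.ends e).Nonempty
      · have hvT : v ∈ T := by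
          simp only [T, Finset.mem_filter, Finset.mem_univ, true_and]
          exact ⟨by simpa using hv, hne⟩
        rw [Finset.sum_congr rfl (g := fun e => y e - 1 / 2) fun e he => by
          simp [D, (Finset.mem_filter.1 he).1], Finset.sum_sub_distrib, hone v hvT,
          Finset.sum_const, ← htwo v hvT]
        norm_num
      · rw [Finset.not_nonempty_iff_eq_empty.1 hne, Finset.sum_empty]
  intro e
  by_cases he : e ∈ F
  · have := congrFun hD e
    simp only [D, he, if_true, Pi.zero_apply] at this
    exact Or.inr (Or.inl (by linarith))
  · rcases hnF e he with h | h
    · exact Or.inl h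
    · exact Or.inr (Or.inr h)

/-! ### The doubled-edge linear program -/

omit [Fintype V] in
theorem sum_double_delta (x : E × Fin 2 → ℝ) (v : V) :
    ∑ p ∈ G.double.delta v, x p = 2 * ∑ e ∈ G.delta v, halfSum x e := by
  rw [delta, Finset.sum_filter, Fintype.sum_prod_type, delta, Finset.sum_filter, Finset.mul_sum]
  refine Finset.sum_congr rfl fun e _ => ?_
  by_cases h : v ∈ G.ends e
  · simp [double, halfSum, h]
    ring
  · simp [double, h]

omit [Fintype V] in
theorem feasible_double_iff {x : E × Fin 2 → ℝ} :
    G.double.Feasible B 2 x ↔ G.Feasible B 1 (halfSum x) ∧ ∀ p, 0 ≤ x p ∧ x p ≤ 1 := by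
  simp only [Feasible, sum_double_delta]
  constructor
  · rintro ⟨h1, h2, h3⟩
    refine ⟨⟨fun v hv => ?_, fun v hv => ?_, fun e => ?_⟩, h3⟩
    · have := h1 v hv; push_cast at this ⊢; linarith
    · have := h2 v hv; push_cast at this ⊢; linarith
    · have h := h3 (e, 0)
      have h' := h3 (e, 1)
      constructor <;> simp only [halfSum] <;> linarith [h.1, h.2, h'.1, h'.2]
  · rintro ⟨⟨h1, h2, -⟩, h3⟩
    refine ⟨fun v hv => ?_, fun v hv => ?_, h3⟩
    · have := h1 v hv; push_cast at this ⊢; linarith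
    · have := h2 v hv; push_cast at this ⊢; linarith

omit [Fintype V] in
theorem sum_double_weight (w : E → ℝ) (x : E × Fin 2 → ℝ) :
    ∑ p : E × Fin 2, w p.1 * x p = 2 * ∑ e, w e * halfSum x e := by
  simp only [Fintype.sum_prod_type, Fin.sum_univ_two, Finset.mul_sum]
  exact Finset.sum_congr rfl fun e _ => by simp only [halfSum]; ring

omit [Fintype V] [Fintype E] in
theorem halfSum_comp_fst (y : E → ℝ) : halfSum (fun p : E × Fin 2 => y p.1) = y := by
  ext e; simp [halfSum]

omit [Fintype V] in
theorem isSolution_double_iff {x : E × Fin 2 → ℝ} :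
    G.double.IsSolution B 2 (fun p => w p.1) x ↔
      G.IsSolution B 1 w (halfSum x) ∧ ∀ p, 0 ≤ x p ∧ x p ≤ 1 := by
  simp only [IsSolution, feasible_double_iff, sum_double_weight]
  constructor
  · rintro ⟨⟨h1, h2⟩, h3⟩
    refine ⟨⟨h1, fun y hy => ?_⟩, h2⟩
    have := h3 (fun p => y p.1) ⟨by rwa [halfSum_comp_fst], fun p => hy.2.2 p.1⟩
    rw [halfSum_comp_fst] at this
    linarith
  · rintro ⟨⟨h1, h3⟩, h2⟩
    exact ⟨⟨h1, h2⟩, fun y hy => by linarith [h3 _ hy.1]⟩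

omit [Fintype V] in
theorem IsUniqueSolution.halfSum {x : E × Fin 2 → ℝ}
    (hx : G.double.IsUniqueSolution B 2 (fun p => w p.1) x) :
    G.IsUniqueSolution B 1 w (halfSum x) := by
  refine ⟨(isSolution_double_iff.1 hx.1).1, fun y hy => ?_⟩
  have h := hx.2 (fun p => y p.1)
    (isSolution_double_iff.2 ⟨by rwa [halfSum_comp_fst], fun p => hy.1.2.2 p.1⟩)
  rw [← h, halfSum_comp_fst]

/-- With equal weights on the copies, a unique optimal solution of the doubled program is `0/1`:
it agrees on the two copies of an edge, and if the common value were `1/2`, it could be replaced by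
`1` and `0`. -/
theorem IsUniqueSolution.double_integral {x : E × Fin 2 → ℝ}
    (hx : G.double.IsUniqueSolution B 2 (fun p => w p.1) x) (p : E × Fin 2) :
    x p = 0 ∨ x p = 1 := by
  have hy := hx.halfSum
  have hcopy : ∀ p, x p = BlossomBP.halfSum x p.1 := fun p =>
    congrFun (hx.2 (fun p => BlossomBP.halfSum x p.1)
      (isSolution_double_iff.2 ⟨by rw [halfSum_comp_fst]; exact hy.1,
        fun p => hy.1.1.2.2 p.1⟩)).symm p
  rcases hy.halfIntegral p.1 with h | h | h
  · exact Or.inl ((hcopy p).trans h)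
  · exfalso
    let z : E × Fin 2 → ℝ := fun q => if q.1 = p.1 then (if q.2 = 0 then 1 else 0) else x q
    have hz : BlossomBP.halfSum z = BlossomBP.halfSum x := by
      ext e
      by_cases he : e = p.1
      · subst he
        rw [h]
        simp [BlossomBP.halfSum, z]
      · simp [BlossomBP.halfSum, z, he]
    have hzx := hx.2 z (isSolution_double_iff.2 ⟨by rw [hz]; exact hy.1, fun q => by
      have := (isSolution_double_iff.1 hx.1).2 q
      simp only [z]
      split_ifs <;> simp [this]⟩)
    have h0 := congrFun hzx (p.1, 0)
    rw [hcopy] at h0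
    simp [z] at h0
    linarith
  · exact Or.inr ((hcopy p).trans h)

/-! ### Perturbed weights on the copies -/

/-- Rounding a half-integral value to the two copies of an edge, with a half going to the lighter
copy. The excess cost of any other pair of values is bounded below by the excess cost of its mean
under the unperturbed weight. -/
theorem exists_rounding {c c₀ c₁ ε y : ℝ} (hy : y = 0 ∨ y = 1 / 2 ∨ y = 1)
    (h₀ : |c₀ - c| ≤ ε) (h₁ : |c₁ - c| ≤ ε) (hne : c₀ ≠ c₁) :
    ∃ a b : ℝ, (a = 0 ∨ a = 1) ∧ (b = 0 ∨ b = 1) ∧ (a + b) / 2 = y ∧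
      ∀ a' b' : ℝ, 0 ≤ a' ∧ a' ≤ 1 → 0 ≤ b' ∧ b' ≤ 1 →
        2 * (c * ((a' + b') / 2 - y)) - 2 * ε * |(a' + b') / 2 - y| ≤
          (c₀ * a' + c₁ * b') - (c₀ * a + c₁ * b) ∧
        ((a' + b') / 2 = y → c₀ * a' + c₁ * b' ≤ c₀ * a + c₁ * b → a' = a ∧ b' = b) := by
  rw [abs_le] at h₀ h₁
  rcases hy with rfl | rfl | rfl
  · refine ⟨0, 0, by simp, by simp, by simp, fun a' b' ha hb => ⟨?_, fun h _ => ?_⟩⟩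
    · rw [abs_of_nonneg (by linarith)]
      nlinarith
    · constructor <;> linarith
  · rcases hne.lt_or_gt with hlt | hlt
    · refine ⟨1, 0, by simp, by simp, by simp, fun a' b' ha hb => ⟨?_, fun h h' => ?_⟩⟩
      · rcases abs_cases ((a' + b') / 2 - 1 / 2) with ⟨h, h'⟩ | ⟨h, h'⟩ <;> rw [h] <;> nlinarith
      · have hb' : b' = 1 - a' := by linarith
        subst hb'
        have : a' = 1 := by nlinarith
        constructor <;> linarith
    · refine ⟨0, 1, by simp, by simp, by simp, fun a' b' ha hb => ⟨?_, fun h h' => ?_⟩⟩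
      · rcases abs_cases ((a' + b') / 2 - 1 / 2) with ⟨h, h'⟩ | ⟨h, h'⟩ <;> rw [h] <;> nlinarith
      · have hb' : b' = 1 - a' := by linarith
        subst hb'
        have : a' = 0 := by nlinarith
        constructor <;> linarith
  · refine ⟨1, 1, by simp, by simp, by simp, fun a' b' ha hb => ⟨?_, fun h _ => ?_⟩⟩
    · rw [abs_of_nonpos (by linarith)]
      nlinarith
    · constructor <;> linarith

/-- Slightly perturbing the weights, differently on the two copies of each edge, makes the doubled
program have a unique optimal solution, which is `0/1` and averages to `y`. -/
theorem IsUniqueSolution.exists_perturbation (hy : G.IsUniqueSolution B 1 w y) :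
    ∃ ε : ℝ, 0 < ε ∧ ∀ w' : E × Fin 2 → ℝ,
      (∀ p, |w' p - w p.1| ≤ ε) → (∀ e, w' (e, 0) ≠ w' (e, 1)) →
      ∃ x : E × Fin 2 → ℝ, G.double.IsUniqueSolution B 2 w' x ∧ (∀ p, x p = 0 ∨ x p = 1) ∧
        BlossomBP.halfSum x = y := by
  obtain ⟨δ, hδ, hsharp⟩ := hy.exists_sharp
  -- Perturbing by at most `δ / 2` on both copies costs `δ` per unit of distance between averages,
  -- half of the sharpness `2 * δ` of the doubled cost.
  refine ⟨δ / 2, by positivity, fun w' hw' hne => ?_⟩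
  choose a b ha hb hab hbound using fun e =>
    exists_rounding (hy.halfIntegral e) (hw' (e, 0)) (hw' (e, 1)) (hne e)
  let x : E × Fin 2 → ℝ := fun p => if p.2 = 0 then a p.1 else b p.1
  have hx01 : ∀ p, x p = 0 ∨ x p = 1 := fun p => by
    simp only [x]; split_ifs
    exacts [ha _, hb _]
  have hxy : BlossomBP.halfSum x = y := by
    ext e
    simpa [BlossomBP.halfSum, x] using hab e
  have hxf : G.double.Feasible B 2 x := feasible_double_iff.2 ⟨hxy ▸ hy.1.1, fun p => by
    rcases hx01 p with h | h <;> simp [h]⟩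
  have hcost : ∀ z : E × Fin 2 → ℝ, ∑ p, w' p * z p - ∑ p, w' p * x p =
      ∑ e, ((w' (e, 0) * z (e, 0) + w' (e, 1) * z (e, 1)) -
        (w' (e, 0) * a e + w' (e, 1) * b e)) := fun z => by
    simp [Fintype.sum_prod_type, x]
  have hgap : ∀ z, G.double.Feasible B 2 z → δ * ∑ e, |BlossomBP.halfSum z e - y e| ≤
      ∑ p, w' p * z p - ∑ p, w' p * x p := by
    intro z hz
    obtain ⟨hz1, hz2⟩ := feasible_double_iff.1 hz
    have h1 := hsharp _ hz1
    rw [hcost]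
    refine le_trans ?_ (Finset.sum_le_sum fun e _ =>
      (hbound e (z (e, 0)) (z (e, 1)) (hz2 _) (hz2 _)).1)
    rw [Finset.sum_sub_distrib, ← Finset.mul_sum, ← Finset.mul_sum]
    simp only [BlossomBP.halfSum] at h1 ⊢
    linarith
  have habs : ∀ z : E × Fin 2 → ℝ, 0 ≤ ∑ e, |BlossomBP.halfSum z e - y e| := fun z =>
    Finset.sum_nonneg fun e _ => abs_nonneg _
  refine ⟨x, ⟨⟨hxf, fun z hz => ?_⟩, fun z hz => ?_⟩, hx01, hxy⟩
  · linarith [hgap z hz, mul_nonneg hδ.le (habs z)]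
  · have h1 := hgap z hz.1
    have h2 := hz.2 x hxf
    obtain ⟨-, hz2⟩ := feasible_double_iff.1 hz.1
    have h3 : ∑ e, |BlossomBP.halfSum z e - y e| = 0 := by
      refine le_antisymm ?_ (habs z)
      by_contra! hpos
      linarith [mul_pos hδ hpos]
    have h4 : ∀ e, (z (e, 0) + z (e, 1)) / 2 = y e := fun e => by
      have := (Finset.sum_eq_zero_iff_of_nonneg fun e _ => abs_nonneg _).1 h3 e
        (Finset.mem_univ e)
      simpa [BlossomBP.halfSum, sub_eq_zero] using this
    have h5 : ∀ e, 0 ≤ (w' (e, 0) * z (e, 0) + w' (e, 1) * z (e, 1)) -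
        (w' (e, 0) * a e + w' (e, 1) * b e) := fun e => by
      simpa [h4] using (hbound e (z (e, 0)) (z (e, 1)) (hz2 _) (hz2 _)).1
    have h6 : ∀ e, z (e, 0) = a e ∧ z (e, 1) = b e := fun e => by
      refine (hbound e (z (e, 0)) (z (e, 1)) (hz2 _) (hz2 _)).2 (h4 e) ?_
      have := Finset.single_le_sum (fun e _ => h5 e) (Finset.mem_univ e)
      rw [← hcost] at this
      linarith
    ext ⟨e, i⟩
    fin_cases i
    · simpa [x] using (h6 e).1
    · simpa [x] using (h6 e).2

end Multigraph

end BlossomBP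

theorem corollary1 {V E : Type*} [Fintype V] [Fintype E]
    (G : BlossomBP.Multigraph V E) (B : Set V) (w : E → ℝ) :
    (∀ x : E × Fin 2 → ℝ,
      G.double.IsUniqueSolution B 2 (fun p => w p.1) x →
        (∀ m₀ : (G.double.degreeGM B 2 (fun p => w p.1)).Messages, m₀.Positive →
          (G.double.degreeGM B 2 (fun p => w p.1)).BPConvergesTo m₀ x) ∧
        G.IsUniqueSolution B 1 w (BlossomBP.halfSum x) ∧
        BlossomBP.HalfIntegral (BlossomBP.halfSum x)) ∧
    (∀ y : E → ℝ, G.IsUniqueSolution B 1 w y →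
      BlossomBP.HalfIntegral y ∧
      ∃ ε : ℝ, 0 < ε ∧ ∀ w' : E × Fin 2 → ℝ,
        (∀ p, |w' p - w p.1| ≤ ε) → (∀ e, w' (e, 0) ≠ w' (e, 1)) →
        ∃ x : E × Fin 2 → ℝ,
          G.double.IsUniqueSolution B 2 w' x ∧
          (∀ m₀ : (G.double.degreeGM B 2 w').Messages, m₀.Positive →
            (G.double.degreeGM B 2 w').BPConvergesTo m₀ x) ∧
          BlossomBP.halfSum x = y) := by
  refine ⟨fun x hx => ⟨fun m₀ hm₀ => hx.bpConvergesTo hx.double_integral m₀ hm₀, hx.halfSum,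
    hx.halfSum.halfIntegral⟩, fun y hy => ⟨hy.halfIntegral, ?_⟩⟩
  obtain ⟨ε, hε, h⟩ := hy.exists_perturbation
  refine ⟨ε, hε, fun w' hw' hne => ?_⟩
  obtain ⟨x, hx, hx01, hxy⟩ := h w' hw' hne
  exact ⟨x, hx, fun m₀ hm₀ => hx.bpConvergesTo hx01 m₀ hm₀, hxy⟩
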